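/- Let $1<\beta<2$ and $E=[0,(\beta-1)^{-1}]$. The random $\beta$-transformation $K$ on $\{0,1\}^{\mathbb N}\times E$ is $K(\omega,x)=(\omega,\beta x)$ if $x<\beta^{-1}$, $K(\omega,x)=(\sigma\omega,\beta x-\omega_1)$ if $\beta^{-1}\le x\le\beta^{-1}(\beta-1)^{-1}$, and $K(\omega,x)=(\omega,\beta x-1)$ if $x>\beta^{-1}(\beta-1)^{-1}$, where $\sigma$ is the left shift; $\pi(\omega,x)=x$. Put $\mathcal O_1=\{\pi(K^n(\omega,1)):n\ge 0,\ \omega\in\{0,1\}^{\mathbb N}\}$. The greedy map $G:E\to E$ is $G(x)=\beta x$ for $x<\beta^{-1}$ and $G(x)=\beta x-1$ for $x\ge\beta^{-1}$. For $N\ge 3$ let $h_N=\beta^{-N}(\beta-1)^{-1}$ and $$F_{\beta,N}=\{x\in E:\ G^n(x)\notin[0,h_N]\text{ for all }n\ge 0\}.$$ Let $P_{\beta,N}=\{0,\beta^{-1},(\beta-1)^{-1}\}\cup\{G^n(1):n\ge0\}\cup\{G^n(h_N):n\ge0\}$. When $P_{\beta,N}$ is finite, let $I_1,\dots,I_m$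 be the open intervals between neighbouring points of $P_{\beta,N}$ that lie to the right of $h_N$, let $S'_{\beta,N}$ be the $m\times m$ matrix whose $(i,j)$ entry is $1$ if $I_j\subseteq G(I_i)$ and $0$ otherwise, and let $\lambda_{\beta,N}$ be the spectral radius of $S'_{\beta,N}$. (1) If $\frac{1+\sqrt5}{2}<\beta<2$ and $\mathcal O_1$ is finite, then for every $N\ge 3$ the set $P_{\beta,N}$ is finite, $\lambda_{\beta,N}\ge 1$, and $$\dim_H F_{\beta,N}=\frac{\log\lambda_{\beta,N}}{\log\beta}.$$ (2) If $\beta\in(1,2)$ is a Pisot number (an algebraic integer $\beta>1$ all of whose other conjugates have modulus less than $1$), then $\mathcal O_1$ is finite, and for every $N\ge 3$ the set $P_{\beta,N}$ is finite, $\lambda_{\beta,N}\ge 1$, and $\dim_H F_{\beta,N}=\log\lambda_{\beta,N}/\log\beta$. -/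

import Mathlib

namespace BetaExpansion

/-- The random `β`-transformation `K` on `{0,1}^ℕ × ℝ` (the space `{0,1}^ℕ × [0, 1/(β-1)]` is
invariant). The first digit of `ω` is `ω 0`, and the left shift is `fun n => ω (n + 1)`. -/
noncomputable def randomMap (β : ℝ) (p : (ℕ → Fin 2) × ℝ) : (ℕ → Fin 2) × ℝ :=
  if p.2 < β⁻¹ then (p.1, β * p.2)
  else if p.2 ≤ β⁻¹ * (β - 1)⁻¹ then (fun n => p.1 (n + 1), β * p.2 - ((p.1 0 : ℕ) : ℝ))
  else (p.1, β * p.2 - 1)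

/-- All the points visited by the possible orbits of `x`, that is `π (K^n (ω, x))` for all `n`
and all `ω`. -/
def possibleOrbits (β x : ℝ) : Set ℝ :=
  {y | ∃ (ω : ℕ → Fin 2) (n : ℕ), y = ((randomMap β)^[n] (ω, x)).2}

/-- The greedy map `G`. -/
noncomputable def greedyMap (β x : ℝ) : ℝ :=
  if x < β⁻¹ then β * x else β * x - 1

/-- The greedy orbit of `x`, starting with `x` itself. -/
def greedyOrbit (β x : ℝ) : Set ℝ :=
  Set.range fun n : ℕ => (greedyMap β)^[n] x

/-- The right end point `β^{-N} (β-1)^{-1}` of the hole. -/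
noncomputable def holeEnd (β : ℝ) (N : ℕ) : ℝ :=
  (β⁻¹) ^ N * (β - 1)⁻¹

/-- The set `F_{β,N}` of the points of `[0, 1/(β-1)]` whose greedy orbit does not hit the hole. -/
def greedySurvivors (β : ℝ) (N : ℕ) : Set ℝ :=
  {x | x ∈ Set.Icc 0 (β - 1)⁻¹ ∧ ∀ y ∈ greedyOrbit β x, y ∉ Set.Icc 0 (holeEnd β N)}

/-- A Pisot number: an algebraic integer `β > 1` all of whose other conjugates lie in the open
unit disc. -/
def IsPisot (β : ℝ) : Prop :=
  1 < β ∧ IsIntegral ℤ β ∧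
    ∀ z : ℂ, Polynomial.aeval z (minpoly ℚ β) = 0 → z ≠ (β : ℂ) → ‖z‖ < 1

/-- The division points of the Markov partition of `[0, 1/(β-1)]`: the end points, the
discontinuity `1/β` of the greedy map, and the greedy orbits of `1` and of the end of the hole. -/
def partitionPoints (β : ℝ) (N : ℕ) : Set ℝ :=
  {0, β⁻¹, (β - 1)⁻¹} ∪ greedyOrbit β 1 ∪ greedyOrbit β (holeEnd β N)

/-- The intervals of the Markov partition that lie outside the hole, each given by its two end
points, which are neighbouring division points. -/
def partitionIntervals (β : ℝ) (N : ℕ) : Set (ℝ × ℝ) :=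
  {I | I.1 ∈ partitionPoints β N ∧ I.2 ∈ partitionPoints β N ∧ I.1 < I.2 ∧
    Disjoint (Set.Ioo I.1 I.2) (partitionPoints β N) ∧ holeEnd β N ≤ I.1}

theorem partitionIntervals_finite {β : ℝ} {N : ℕ} (h : (partitionPoints β N).Finite) :
    (partitionIntervals β N).Finite :=
  (h.prod h).subset fun _ hI => ⟨hI.1, hI.2.1⟩

open Classical in
/-- The adjacency matrix of the Markov partition with the hole deleted: the entry at `(I, J)` is
`1` if the greedy map carries the (open) interval `I` over the (open) interval `J`, and `0`
otherwise. -/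
noncomputable def transitionMatrix (β : ℝ) (N : ℕ) :
    Matrix (partitionIntervals β N) (partitionIntervals β N) ℂ :=
  Matrix.of fun I J =>
    if Set.Ioo J.1.1 J.1.2 ⊆ greedyMap β '' Set.Ioo I.1.1 I.1.2 then 1 else 0

open Classical in
/-- The spectral radius of the (finite) adjacency matrix. -/
noncomputable def transitionRadius (β : ℝ) (N : ℕ) (h : (partitionPoints β N).Finite) : ℝ :=
  letI : Fintype (partitionIntervals β N) := (partitionIntervals_finite h).fintype
  (spectralRadius ℂ (transitionMatrix β N)).toReal

end BetaExpansion

/-! When `partitionPoints` is finite it is mapped into itself by $G$, and it contains the one-sided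
limits of $G$ at $\beta^{-1}$. So the partition is Markov: an interval that $G(I)$ meets is covered
by it. Up to a countable set, survivors are the points whose orbit stays in the intervals right of
the hole, and it remains to compute the dimension of this trapped set for a 0-1 matrix $B$ with
spectral radius $\rho$.

Upper bound: paths of length $n$ index a cover by sets of diameter $O(\beta^{-n})$, and Gelfand's
formula bounds their number by $O(\mu^n)$ for any $\mu>\rho$. Lower bound: for infinitely many $n$
the trace of $B^n$ is at least $\rho^n/2$, so some interval has about $\rho^n$ affine branches of
$G^{-n}$ into itself; a separated subfamily generates a self-similar set inside the trapped set
(`IsMarkovFamily.le_dimH_of_diag`). Neither irreducibility nor Perron–Frobenius is needed.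

Finiteness: the greedy orbit of 1 lies in $\mathcal O_1$. Above the golden ratio, $h_N$ climbs to
$h_1$ and then to $(\beta-1)^{-1}-1$, whose greedy orbit is the mirror image of the lazy orbit of 1.
For Pisot $\beta$, orbit points, scaled by a fixed factor, are algebraic integers of $\mathbb
Q(\beta)$ with all conjugates bounded, so there are finitely many. -/

/-! ### Spectral radius and growth of powers of matrices -/

-- Both sides are multiplicative in `p`, so constants and linear factors suffice.
open Polynomial in
theorem Matrix.det_aeval_eq_prod_roots_charpoly {ι K : Type*} [Fintype ι] [DecidableEq ι] [Field K]
    [IsAlgClosed K] (A : Matrix ι ι K) (p : K[X]) :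
    (aeval A p).det = (A.charpoly.roots.map fun l => p.eval l).prod := by
  let φ : K[X] →* K := Matrix.detMonoidHom.comp (aeval A : K[X] →ₐ[K] Matrix ι ι K).toMonoidHom
  let ψ : K[X] →* K :=
    { toFun := fun p => (A.charpoly.roots.map fun l => p.eval l).prod
      map_one' := by simp
      map_mul' := fun p q => by simp [Multiset.prod_map_mul] }
  have hcard : A.charpoly.roots.card = Fintype.card ι := by
    rw [← A.charpoly_natDegree_eq_dim]
    exact ((splits_iff_card_roots).1 (IsAlgClosed.splits A.charpoly))
  have hC : ∀ a, φ (C a) = ψ (C a) := fun a => by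
    simp [φ, ψ, hcard, Matrix.algebraMap_eq_diagonal]
  have hX : ∀ r, φ (X - C r) = ψ (X - C r) := fun r => by
    have h1 : A.charpoly.eval r = (A.charpoly.roots.map fun l => r - l).prod := by
      conv_lhs => rw [(IsAlgClosed.splits A.charpoly).eq_prod_roots_of_monic A.charpoly_monic]
      rw [eval_multiset_prod, Multiset.map_map]
      simp
    have h2 : A.charpoly.eval r = (Matrix.scalar ι r - A).det := by rw [Matrix.eval_charpoly]
    have h3 : φ (X - C r) = (-1) ^ Fintype.card ι * (Matrix.scalar ι r - A).det := by
      rw [← Matrix.det_neg]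
      simp [φ, Matrix.algebraMap_eq_diagonal, Matrix.scalar_apply, Pi.algebraMap_def]
    have h4 : ψ (X - C r) = (-1) ^ Fintype.card ι * (A.charpoly.roots.map fun l => r - l).prod := by
      have : ∀ s : Multiset K, (s.map fun l => l - r).prod =
          (-1) ^ s.card * (s.map fun l => r - l).prod := fun s => by
        induction s using Multiset.induction with
        | empty => simp
        | cons a s ih => simp [ih, pow_succ]; ring
      simpa [ψ, hcard] using this A.charpoly.roots
    rw [h3, h4, ← h1, h2]
  have key : φ p = ψ p := by
    rw [(IsAlgClosed.splits p).eq_prod_roots, map_mul, map_mul, hC, map_multiset_prod,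
      map_multiset_prod, Multiset.map_map, Multiset.map_map]
    congr 2
    exact Multiset.map_congr rfl fun r _ => hX r
  exact key

-- The characteristic polynomial of `A ^ n` at `c` is the determinant of `C c - X ^ n` evaluated at
-- `A`, which yields the eigenvalues with multiplicity.
open Polynomial in
theorem Matrix.trace_pow_eq_sum_roots_charpoly {ι K : Type*} [Fintype ι] [DecidableEq ι] [Field K]
    [IsAlgClosed K] (A : Matrix ι ι K) (n : ℕ) :
    (A ^ n).trace = (A.charpoly.roots.map fun l => l ^ n).sum := by
  have : Infinite K := IsAlgClosed.instInfinite
  have key : (A ^ n).charpoly = ((A.charpoly.roots.map fun l => l ^ n).map fun l => X - C l).prod := by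
    refine Polynomial.funext fun c => ?_
    have := A.det_aeval_eq_prod_roots_charpoly (C c - X ^ n)
    rw [Matrix.eval_charpoly, eval_multiset_prod, Multiset.map_map, Multiset.map_map]
    simpa [Matrix.algebraMap_eq_diagonal, Matrix.scalar_apply, Pi.algebraMap_def] using this
  rw [Matrix.trace_eq_sum_roots_charpoly, key, roots_multiset_prod_X_sub_C]

/-- The phases form one point of a compact torus, and its powers return near the identity infinitely
often. -/
theorem Complex.frequently_half_norm_pow_le_re (S : Finset ℂ) :
    ∃ᶠ n : ℕ in Filter.atTop, ∀ l ∈ S, ‖l‖ ^ n / 2 ≤ (l ^ n).re := by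
  let u : S → Circle := fun l => Circle.exp (Complex.arg l)
  have hu : ∀ l : S, (l : ℂ) = ‖(l : ℂ)‖ * (u l : ℂ) := fun l => by
    simp [u]
  have h := mapClusterPt_one_atTop_pow u
  have hV : {v : S → Circle | ∀ l, (1 / 2 : ℝ) < (v l : ℂ).re} ∈ nhds (1 : S → Circle) := by
    refine IsOpen.mem_nhds ?_ ?_
    · simp only [Set.ofPred_forall]
      refine isOpen_iInter_of_finite fun l => ?_
      exact isOpen_lt continuous_const (by fun_prop)
    · intro l
      norm_num
  refine ((mapClusterPt_iff_frequently.1 h) _ hV).mono fun n hn l hl => ?_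
  have := hn ⟨l, hl⟩
  have h2 := hu ⟨l, hl⟩
  simp only at h2
  conv_rhs => rw [h2]
  rw [mul_pow, ← Complex.ofReal_pow, Complex.re_ofReal_mul]
  simp only [Pi.pow_apply, Circle.coe_pow] at this
  have h3 : 0 ≤ ‖l‖ ^ n := by positivity
  nlinarith

/-- At the return times no eigenvalue contributes negatively to the real part of the trace, so a
single eigenvalue of maximal modulus bounds it below; some diagonal entry reaches the average. -/
theorem Matrix.frequently_exists_spectralRadius_pow_le_diag {ι : Type*} [Fintype ι] [DecidableEq ι]
    [Nonempty ι] (B : Matrix ι ι ℕ) :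
    ∃ᶠ n : ℕ in Filter.atTop, ∃ i, (spectralRadius ℂ (B.map (Nat.cast : ℕ → ℂ))).toReal ^ n /
      (2 * Fintype.card ι) ≤ ((B ^ n) i i : ℝ) := by
  set A := B.map (Nat.cast : ℕ → ℂ) with hA
  let _ : NormedRing (Matrix ι ι ℂ) := Matrix.linftyOpNormedRing
  let _ : NormedAlgebra ℂ (Matrix ι ι ℂ) := Matrix.linftyOpNormedAlgebra
  obtain ⟨k, hk, hk'⟩ := spectrum.exists_nnnorm_eq_spectralRadius A
  have hρ : (spectralRadius ℂ A).toReal = ‖k‖ := by rw [← hk']; simp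
  have hpow : ∀ n, A ^ n = (B ^ n).map (Nat.cast : ℕ → ℂ) := fun n => by
    have := Matrix.map_pow B (Nat.castRingHom ℂ) n
    simpa [hA] using this.symm
  refine (Complex.frequently_half_norm_pow_le_re A.charpoly.roots.toFinset).mono fun n hn => ?_
  have hk2 : k ∈ A.charpoly.roots := by
    rw [Polynomial.mem_roots A.charpoly_monic.ne_zero]
    exact Matrix.mem_spectrum_iff_isRoot_charpoly.1 hk
  have h1 : ‖k‖ ^ n / 2 ≤ ((A ^ n).trace).re := by
    rw [Matrix.trace_pow_eq_sum_roots_charpoly, ← Complex.coe_reAddGroupHom, map_multiset_sum,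
      Multiset.map_map]
    refine (hn k (by simpa using hk2)).trans ?_
    refine Multiset.single_le_sum ?_ _ (Multiset.mem_map.2 ⟨k, hk2, rfl⟩)
    intro x hx
    obtain ⟨l, hl, rfl⟩ := Multiset.mem_map.1 hx
    exact le_trans (by positivity) (hn l (by simpa using hl))
  have h2 : ((A ^ n).trace).re = ∑ i, ((B ^ n) i i : ℝ) := by
    rw [hpow]; simp [Matrix.trace]
  rw [h2] at h1
  by_contra! hcon
  have h3 := Finset.sum_lt_sum_of_nonempty (Finset.univ_nonempty (α := ι)) fun i _ => hcon i
  rw [Finset.sum_const, Finset.card_univ, nsmul_eq_mul, hρ] at h3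
  have h4 : (0 : ℝ) < Fintype.card ι := by exact_mod_cast Fintype.card_pos
  have h5 : (Fintype.card ι : ℝ) * (‖k‖ ^ n / (2 * Fintype.card ι)) = ‖k‖ ^ n / 2 := by
    field_simp
  linarith

/-- Gelfand's formula for the operator norm on $\ell^\infty$, which is the maximal absolute row sum.
-/
theorem Matrix.eventually_sum_pow_le_of_spectralRadius_lt {ι : Type*} [Fintype ι] [DecidableEq ι]
    [Nonempty ι] (B : Matrix ι ι ℕ) {μ : ℝ}
    (hμ : (spectralRadius ℂ (B.map (Nat.cast : ℕ → ℂ))).toReal < μ) :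
    ∀ᶠ n : ℕ in Filter.atTop, ∀ i, ∑ j, ((B ^ n) i j : ℝ) ≤ μ ^ n := by
  set A := B.map (Nat.cast : ℕ → ℂ) with hA
  let _ : NormedRing (Matrix ι ι ℂ) := Matrix.linftyOpNormedRing
  let _ : NormedAlgebra ℂ (Matrix ι ι ℂ) := Matrix.linftyOpNormedAlgebra
  have hpow : ∀ n, A ^ n = (B ^ n).map (Nat.cast : ℕ → ℂ) := fun n => by
    have := Matrix.map_pow B (Nat.castRingHom ℂ) n
    simpa [hA] using this.symm
  obtain ⟨k, hk, hk'⟩ := spectrum.exists_nnnorm_eq_spectralRadius A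
  have hlt : spectralRadius ℂ A < ENNReal.ofReal μ := by
    rw [ENNReal.lt_ofReal_iff_toReal_lt (by rw [← hk']; simp)]
    exact hμ
  have hμ0 : 0 ≤ μ := ENNReal.toReal_nonneg.trans hμ.le
  have h := (spectrum.pow_nnnorm_pow_one_div_tendsto_nhds_spectralRadius A).eventually
    (gt_mem_nhds hlt)
  filter_upwards [h, Filter.eventually_gt_atTop 0] with n hn hn0 i
  have h1 : ‖A ^ n‖ ≤ μ ^ n := by
    have h2 : (‖A ^ n‖₊ : ENNReal) ≤ ENNReal.ofReal μ ^ n := by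
      have h3 := ENNReal.rpow_le_rpow hn.le (Nat.cast_nonneg n)
      rw [← ENNReal.rpow_mul, one_div, inv_mul_cancel₀ (by positivity), ENNReal.rpow_one,
        ENNReal.rpow_natCast] at h3
      exact h3
    rw [← ENNReal.ofReal_pow hμ0] at h2
    have h4 := ENNReal.toReal_mono ENNReal.ofReal_ne_top h2
    rwa [ENNReal.toReal_ofReal (by positivity)] at h4
  refine le_trans ?_ h1
  have h5 : ∑ j, ‖(A ^ n) i j‖₊ ≤ ‖A ^ n‖₊ := by
    rw [Matrix.linfty_opNNNorm_def]
    exact Finset.le_sup (f := fun i => ∑ j, ‖(A ^ n) i j‖₊) (Finset.mem_univ i)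
  have h6 := NNReal.coe_le_coe.2 h5
  rw [hpow] at h6 ⊢
  simpa using h6

/-! ### Bounds for Hausdorff dimension -/

open Filter MeasureTheory in
theorem dimH_le_of_forall_cover {X : Set ℝ} {C K β μ : ℝ} (hC : 0 ≤ C) (hβ : 1 < β)
    (hμ : 1 ≤ μ) (h : ∀ᶠ n : ℕ in atTop, ∃ t : Finset (Set ℝ), X ⊆ ⋃ u ∈ t, u ∧
      (∀ u ∈ t, ∀ x ∈ u, ∀ y ∈ u, |x - y| ≤ C * (β⁻¹) ^ n) ∧ (t.card : ℝ) ≤ K * μ ^ n) :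
    dimH X ≤ ENNReal.ofReal (Real.log μ / Real.log β) := by
  obtain ⟨t, ht⟩ := h.choice
  have hβ0 : 0 < β := by linarith
  have hlog : 0 < Real.log β := Real.log_pos hβ
  set d : ℝ := Real.log μ / Real.log β with hd
  have hd0 : 0 ≤ d := div_nonneg (Real.log_nonneg hμ) hlog.le
  have hβd : β ^ d = μ := by
    rw [Real.rpow_def_of_pos hβ0, hd, mul_div_cancel₀ _ hlog.ne', Real.exp_log (by linarith)]
  have hinv : ∀ n : ℕ, ((β⁻¹) ^ n) ^ d = (μ ^ n)⁻¹ := fun n => by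
    rw [inv_pow, Real.inv_rpow (by positivity), ← Real.rpow_natCast, ← Real.rpow_mul hβ0.le,
      mul_comm, Real.rpow_mul hβ0.le, hβd, Real.rpow_natCast]
  have hdiam : ∀ᶠ n in atTop, ∀ u : t n, Metric.ediam (u : Set ℝ) ≤
      ENNReal.ofReal (C * (β⁻¹) ^ n) := by
    filter_upwards [ht] with n hn u
    refine Metric.ediam_le fun x hx y hy => ?_
    rw [edist_dist, Real.dist_eq]
    exact ENNReal.ofReal_le_ofReal (hn.2.1 u u.2 x hx y hy)
  have hr : Tendsto (fun n : ℕ => ENNReal.ofReal (C * (β⁻¹) ^ n)) atTop (nhds 0) := by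
    rw [← ENNReal.ofReal_zero]
    refine ENNReal.tendsto_ofReal ?_
    simpa using (tendsto_pow_atTop_nhds_zero_of_lt_one (r := β⁻¹) (by positivity)
      (inv_lt_one_of_one_lt₀ hβ)).const_mul C
  have hle := Measure.hausdorffMeasure_le_liminf_sum d X _ hr (fun n (u : t n) => (u : Set ℝ))
    hdiam (by
      filter_upwards [ht] with n hn x hx
      obtain ⟨u, hu, hxu⟩ := Set.mem_iUnion₂.1 (hn.1 hx)
      exact Set.mem_iUnion.2 ⟨⟨u, hu⟩, hxu⟩)
  have hbound : liminf (fun n => ∑ u : t n, Metric.ediam (u : Set ℝ) ^ d) atTop ≤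
      ENNReal.ofReal (K * C ^ d) := by
    refine liminf_le_of_frequently_le' (Eventually.frequently ?_)
    filter_upwards [hdiam, ht] with n hn hn'
    calc ∑ u : t n, Metric.ediam (u : Set ℝ) ^ d
        ≤ ∑ _u : t n, ENNReal.ofReal (C ^ d * (μ ^ n)⁻¹) := by
          refine Finset.sum_le_sum fun u _ => ?_
          rw [← hinv, ← Real.mul_rpow hC (by positivity),
            ← ENNReal.ofReal_rpow_of_nonneg (by positivity) hd0]
          exact ENNReal.rpow_le_rpow (hn u) hd0
      _ = ENNReal.ofReal ((t n).card * (C ^ d * (μ ^ n)⁻¹)) := by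
          rw [Finset.sum_const, Finset.card_univ, Fintype.card_coe, nsmul_eq_mul,
            ENNReal.ofReal_mul (p := ((t n).card : ℝ)) (by positivity), ENNReal.ofReal_natCast]
      _ ≤ ENNReal.ofReal (K * C ^ d) := by
          refine ENNReal.ofReal_le_ofReal ?_
          have hμn : (0 : ℝ) < μ ^ n := by positivity
          calc ((t n).card : ℝ) * (C ^ d * (μ ^ n)⁻¹) ≤ (K * μ ^ n) * (C ^ d * (μ ^ n)⁻¹) :=
                mul_le_mul_of_nonneg_right hn'.2.2 (by positivity)
            _ = K * C ^ d := by field_simp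
  have hfin : Measure.hausdorffMeasure (d.toNNReal : ℝ) X ≠ ⊤ := by
    rw [Real.coe_toNNReal _ hd0]
    exact ((hle.trans hbound).trans_lt ENNReal.ofReal_lt_top).ne
  exact dimH_le_of_hausdorffMeasure_ne_top hfin

/-- Reading the code of a point as a base-`M` expansion gives an `s`-Hölder map of the range onto
$[0,1]$, where $r^s=1/M$. -/
theorem le_dimH_range_of_separated {M : ℕ} (hM : 1 < M) (x : (ℕ → Fin M) → ℝ) {r δ : ℝ}
    (hr0 : 0 < r) (hr1 : r < 1) (hδ : 0 < δ)
    (hsep : ∀ a b k, (∀ i < k, a i = b i) → a k ≠ b k → δ * r ^ k ≤ |x a - x b|) :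
    ENNReal.ofReal (Real.log M / -Real.log r) ≤ dimH (Set.range x) := by
  have hM0 : (1 : ℝ) < M := by exact_mod_cast hM
  have hlogr : 0 < -Real.log r := neg_pos.2 (Real.log_neg hr0 hr1)
  set s : ℝ := Real.log M / -Real.log r with hs
  have hs0 : 0 < s := div_pos (Real.log_pos hM0) hlogr
  have hrs : r ^ s = (M : ℝ)⁻¹ := by
    rw [Real.rpow_def_of_pos hr0, hs, ← Real.exp_log (show (0 : ℝ) < M by linarith),
      ← Real.exp_neg, Real.log_exp]
    congr 1
    field_simp [(neg_pos.1 (by simpa using hlogr) : Real.log r < 0).ne]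
  have hfirst : ∀ a b : ℕ → Fin M, a ≠ b → ∃ k, (∀ i < k, a i = b i) ∧ a k ≠ b k := by
    intro a b hab
    obtain ⟨k, hk⟩ := Function.ne_iff.1 hab
    classical
    have hex : ∃ k, a k ≠ b k := ⟨k, hk⟩
    exact ⟨Nat.find hex, fun i hi => not_not.1 (Nat.find_min hex hi), Nat.find_spec hex⟩
  have hinj : Function.Injective x := by
    intro a b hab
    by_contra hne
    obtain ⟨k, hk, hk'⟩ := hfirst a b hne
    have := hsep a b k hk hk'
    rw [hab, sub_self, abs_zero] at this
    exact absurd this (not_le.2 (by positivity))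
  have hne : Nonempty (ℕ → Fin M) := ⟨fun _ => ⟨0, by omega⟩⟩
  set f : ℝ → ℝ := fun y => Real.ofDigits (Function.invFun x y) with hf
  have hfx : ∀ a, f (x a) = Real.ofDigits a := fun a => by
    simp only [hf]
    rw [Function.leftInverse_invFun hinj a]
  have hH : HolderOnWith ((δ⁻¹) ^ s).toNNReal s.toNNReal f (Set.range x) := by
    rintro _ ⟨a, rfl⟩ _ ⟨b, rfl⟩
    rw [hfx, hfx, edist_dist, edist_dist, Real.dist_eq, Real.dist_eq, Real.coe_toNNReal _ hs0.le,
      ENNReal.ofReal_rpow_of_nonneg (abs_nonneg _) hs0.le]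
    change _ ≤ ENNReal.ofReal _ * _
    rw [← ENNReal.ofReal_mul (by positivity), ← Real.mul_rpow (by positivity) (abs_nonneg _)]
    refine ENNReal.ofReal_le_ofReal ?_
    by_cases hab : a = b
    · subst hab
      simp only [sub_self, abs_zero]
      positivity
    obtain ⟨k, hk, hk'⟩ := hfirst a b hab
    refine (Real.abs_ofDigits_sub_ofDigits_le hk).trans ?_
    have h1 : ((M : ℝ) ^ k)⁻¹ = (r ^ k) ^ s := by
      rw [← Real.rpow_natCast r, ← Real.rpow_mul hr0.le, mul_comm, Real.rpow_mul hr0.le, hrs,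
        Real.rpow_natCast, inv_pow]
    rw [h1]
    refine Real.rpow_le_rpow (by positivity) ?_ hs0.le
    rw [inv_mul_eq_div, le_div_iff₀ hδ, mul_comm]
    exact hsep a b k hk hk'
  have himg : Set.Icc (0 : ℝ) 1 ⊆ f '' Set.range x := by
    intro y hy
    obtain ⟨a, -, ha⟩ := Real.ofDigits_SurjOn hM hy
    exact ⟨x a, ⟨a, rfl⟩, by rw [hfx, ha]⟩
  have h1 : (1 : ENNReal) ≤ dimH (f '' Set.range x) := by
    refine le_trans (le_of_eq ?_) (dimH_mono himg)
    rw [Real.dimH_of_nonempty_interior (by rw [interior_Icc]; exact ⟨1 / 2, by norm_num⟩)]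
    simp
  have h2 := h1.trans (hH.dimH_image_le (by simpa using hs0))
  have hne0 : (s.toNNReal : ENNReal) ≠ 0 := by simpa using hs0
  rw [ENNReal.le_div_iff_mul_le (Or.inl hne0) (Or.inl ENNReal.coe_ne_top), one_mul] at h2
  exact h2

/-- `S` is the attractor of the maps $y\mapsto ry+t$. The strict inequalities keep it off the end
points; images have length $r(b-a)$, so the assumed spacing leaves a gap of that size. -/
theorem exists_selfSimilar_subset_Ioo {T : Finset ℝ} (hT : 1 < T.card) {r a b : ℝ} (hr0 : 0 < r)
    (hr1 : r < 1) (hab : a < b) (hTa : ∀ t ∈ T, a < r * a + t) (hTb : ∀ t ∈ T, r * b + t < b)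
    (hsep : ∀ t ∈ T, ∀ t' ∈ T, t ≠ t' → 2 * (r * (b - a)) ≤ |t - t'|) :
    ∃ S ⊆ Set.Ioo a b, (∀ y ∈ S, ∃ t ∈ T, ∃ y' ∈ S, y = r * y' + t) ∧
      ENNReal.ofReal (Real.log T.card / -Real.log r) ≤ dimH S := by
  let e : Fin T.card ≃ T := T.equivFin.symm
  let x : (ℕ → Fin T.card) → ℝ := fun w => ∑' k, r ^ k * (e (w k) : ℝ)
  have hgeo : HasSum (fun k : ℕ => r ^ k) (1 - r)⁻¹ := hasSum_geometric_of_lt_one hr0.le hr1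
  have h1r : (1 - r) ≠ 0 := by linarith
  -- Writing `a` and `b` as geometric series allows termwise comparison with the series of `x w`.
  have hca : HasSum (fun k : ℕ => r ^ k * (a * (1 - r))) a := by
    simpa [h1r, mul_comm, mul_assoc] using hgeo.mul_right (a * (1 - r))
  have hcb : HasSum (fun k : ℕ => r ^ k * (b * (1 - r))) b := by
    simpa [h1r, mul_comm, mul_assoc] using hgeo.mul_right (b * (1 - r))
  have hsum : ∀ w : ℕ → Fin T.card, Summable fun k => r ^ k * (e (w k) : ℝ) := fun w => by
    have hs := (hcb.summable.sub hca.summable)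
    have h0 : Summable fun k => r ^ k * (e (w k) : ℝ) - r ^ k * (a * (1 - r)) := by
      refine Summable.of_nonneg_of_le (fun k => ?_) (fun k => ?_) hs
      · rw [← mul_sub]
        have := hTa _ (e (w k)).2
        exact mul_nonneg (by positivity) (by linarith)
      · rw [← mul_sub, ← mul_sub]
        have := hTb _ (e (w k)).2
        exact mul_le_mul_of_nonneg_left (by linarith) (by positivity)
    simpa using h0.add hca.summable
  have hxa : ∀ w, a ≤ x w := fun w =>
    hasSum_le (fun k => mul_le_mul_of_nonneg_left
      (by have := hTa _ (e (w k)).2; linarith) (by positivity)) hca (hsum w).hasSum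
  have hxb : ∀ w, x w ≤ b := fun w =>
    hasSum_le (fun k => mul_le_mul_of_nonneg_left
      (by have := hTb _ (e (w k)).2; linarith) (by positivity)) (hsum w).hasSum hcb
  have hrec : ∀ w, x w = r * x (fun k => w (k + 1)) + e (w 0) := fun w => by
    simp only [x]
    rw [(hsum w).tsum_eq_zero_add, ← tsum_mul_left, pow_zero, one_mul, add_comm]
    congr 1
    exact tsum_congr fun k => by ring
  refine ⟨Set.range x, ?_, ?_, ?_⟩
  · rintro _ ⟨w, rfl⟩
    have h1 := hTa _ (e (w 0)).2
    have h2 := hTb _ (e (w 0)).2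
    have h3 := hxa fun k => w (k + 1)
    have h4 := hxb fun k => w (k + 1)
    rw [hrec w]
    constructor <;> nlinarith
  · rintro _ ⟨w, rfl⟩
    exact ⟨e (w 0), (e (w 0)).2, _, ⟨fun k => w (k + 1), rfl⟩, hrec w⟩
  · refine le_dimH_range_of_separated hT x hr0 hr1 (δ := r * (b - a))
      (mul_pos hr0 (sub_pos.2 hab)) fun w v k => ?_
    induction k generalizing w v with
    | zero =>
      intro _ h0
      have h1 := hsep _ (e (w 0)).2 _ (e (v 0)).2
        (fun h => h0 (e.injective (Subtype.ext h)))
      have h2 := hxa fun k => w (k + 1)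
      have h3 := hxb fun k => w (k + 1)
      have h4 := hxa fun k => v (k + 1)
      have h5 := hxb fun k => v (k + 1)
      rw [hrec w, hrec v, pow_zero, mul_one]
      rcases le_abs.1 h1 with h | h
      · exact le_abs.2 (Or.inl (by nlinarith))
      · exact le_abs.2 (Or.inr (by nlinarith))
    | succ k ih =>
      intro h hk
      have h1 := ih (fun k => w (k + 1)) (fun k => v (k + 1)) (fun i hi => h (i + 1) (by omega)) hk
      rw [hrec w, hrec v, h 0 (by omega), add_sub_add_right_eq_sub, ← mul_sub, abs_mul,
        abs_of_pos hr0, pow_succ]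
      nlinarith


/-! ### Dimension of the trapped set of a Markov family -/

section

open Filter

/-- The points whose `G`-orbit never leaves the union of the intervals `(a i, b i)`. -/
def orbitTrapped {ι : Type*} (G : ℝ → ℝ) (a b : ι → ℝ) : Set ℝ :=
  {x | ∀ n : ℕ, ∃ i, G^[n] x ∈ Set.Ioo (a i) (b i)}

/-- A finite family of disjoint intervals on which `G` is affine with slope `β`, and a `0`-`1`
matrix recording which intervals are mapped over which. -/
structure IsMarkovFamily {ι : Type*} (β : ℝ) (G : ℝ → ℝ) (a b d : ι → ℝ) (B : Matrix ι ι ℕ) :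
    Prop where
  one_lt : 1 < β
  lt : ∀ i, a i < b i
  eq_of_mem : ∀ i j x, x ∈ Set.Ioo (a i) (b i) → x ∈ Set.Ioo (a j) (b j) → i = j
  map_eq : ∀ i x, x ∈ Set.Ioo (a i) (b i) → G x = β * x - d i
  le_one : ∀ i j, B i j ≤ 1
  one_of_mem : ∀ i j x, x ∈ Set.Ioo (a i) (b i) → G x ∈ Set.Ioo (a j) (b j) → B i j = 1
  subset_image : ∀ i j, B i j = 1 → Set.Ioo (a j) (b j) ⊆ G '' Set.Ioo (a i) (b i)

namespace IsMarkovFamily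

variable {ι : Type*} {β : ℝ} {G : ℝ → ℝ} {a b d : ι → ℝ} {B : Matrix ι ι ℕ}

theorem inverse_branch (h : IsMarkovFamily β G a b d B) {i j : ι} (hij : B i j = 1) {z : ℝ}
    (hz : z ∈ Set.Ioo (a j) (b j)) :
    (z + d i) / β ∈ Set.Ioo (a i) (b i) ∧ G ((z + d i) / β) = z := by
  obtain ⟨w, hw, hwz⟩ := h.subset_image i j hij hz
  have hβ : β ≠ 0 := by linarith [h.one_lt]
  have : (z + d i) / β = w := by
    rw [← hwz, h.map_eq i w hw]; field_simp; ring
  rw [this]; exact ⟨hw, hwz⟩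

/-- Covers are pulled back along inverse branches, each contracting by $\beta^{-1}$; the count is
that of paths from `i`. -/
theorem exists_cover [Fintype ι] [DecidableEq ι] (h : IsMarkovFamily β G a b d B) {C : ℝ}
    (hC : ∀ i, b i - a i ≤ C) (n : ℕ) (i : ι) :
    ∃ t : Finset (Set ℝ), orbitTrapped G a b ∩ Set.Ioo (a i) (b i) ⊆ ⋃ u ∈ t, u ∧
      (∀ u ∈ t, ∀ x ∈ u, ∀ y ∈ u, |x - y| ≤ C * (β⁻¹) ^ n) ∧ t.card ≤ ∑ j, (B ^ n) i j := by
  classical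
  induction n generalizing i with
  | zero =>
    refine ⟨{Set.Ioo (a i) (b i)}, by simp, ?_, by simp [Matrix.one_apply]⟩
    simp only [Finset.mem_singleton, forall_eq, pow_zero, mul_one, Set.mem_Ioo]
    intro x hx y hy
    exact abs_le.2 ⟨by linarith [hC i], by linarith [hC i]⟩
  | succ n ih =>
    choose t ht1 ht2 ht3 using ih
    have hβ : 0 < β := by linarith [h.one_lt]
    refine ⟨(Finset.univ.filter fun k => B i k = 1).biUnion fun k =>
      (t k).image fun u => (fun z => (z + d i) / β) '' u, ?_, ?_, ?_⟩
    · rintro x ⟨hx, hxi⟩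
      obtain ⟨k, hk⟩ := hx 1
      have hGx : G x ∈ orbitTrapped G a b := fun m => hx (m + 1)
      obtain ⟨u, hu, hxu⟩ := Set.mem_iUnion₂.1 (ht1 k ⟨hGx, hk⟩)
      refine Set.mem_iUnion₂.2 ⟨_, Finset.mem_biUnion.2 ⟨k, ?_, Finset.mem_image_of_mem _ hu⟩,
        G x, hxu, ?_⟩
      · simpa using h.one_of_mem i k x hxi hk
      · simp only [h.map_eq i x hxi]; field_simp; ring
    · intro u hu
      obtain ⟨k, -, hk⟩ := Finset.mem_biUnion.1 hu
      obtain ⟨v, hv, rfl⟩ := Finset.mem_image.1 hk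
      rintro _ ⟨x, hx, rfl⟩ _ ⟨y, hy, rfl⟩
      have h1 := ht2 k v hv x hx y hy
      have h2 : (x + d i) / β - (y + d i) / β = β⁻¹ * (x - y) := by field_simp; ring
      simp only [h2]
      rw [abs_mul, abs_of_pos (inv_pos.2 hβ), pow_succ]
      nlinarith [inv_pos.2 hβ]
    · calc _ ≤ ∑ k ∈ Finset.univ.filter (fun k => B i k = 1), ∑ j, (B ^ n) k j :=
            Finset.card_biUnion_le.trans (Finset.sum_le_sum fun k _ =>
              Finset.card_image_le.trans (ht3 k))
        _ ≤ ∑ k, B i k * ∑ j, (B ^ n) k j := by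
            rw [Finset.sum_filter]
            refine Finset.sum_le_sum fun k _ => ?_
            split_ifs with hk <;> simp [hk]
        _ = ∑ j, (B ^ (n + 1)) i j := by
            simp only [pow_succ', Matrix.mul_apply, Finset.mul_sum]
            exact Finset.sum_comm

/-- Each path from `i` to `j` gives an inverse branch of $G^n$. Different paths give different
translations because the intervals are disjoint. -/
theorem exists_translations [Fintype ι] [DecidableEq ι] (h : IsMarkovFamily β G a b d B) (n : ℕ)
    (i j : ι) :
    ∃ T : Finset ℝ, T.card = (B ^ n) i j ∧ ∀ t ∈ T, ∀ y ∈ Set.Ioo (a j) (b j),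
      (β⁻¹) ^ n * y + t ∈ Set.Ioo (a i) (b i) ∧ G^[n] ((β⁻¹) ^ n * y + t) = y ∧
      ∀ k ≤ n, ∃ l, G^[k] ((β⁻¹) ^ n * y + t) ∈ Set.Ioo (a l) (b l) := by
  classical
  induction n generalizing i with
  | zero =>
    by_cases hij : i = j
    · subst hij
      refine ⟨{0}, by simp, ?_⟩
      simp only [Finset.mem_singleton, forall_eq, pow_zero, one_mul, add_zero]
      exact fun y hy => ⟨hy, rfl, fun k hk => ⟨i, by rw [Nat.le_zero.1 hk]; exact hy⟩⟩
    · exact ⟨∅, by simp [hij], by simp⟩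
  | succ n ih =>
    choose T hcard hT using ih
    have hβ : 0 < β := by linarith [h.one_lt]
    have hdiv : ∀ t y : ℝ, (β⁻¹) ^ (n + 1) * y + (t + d i) / β = ((β⁻¹) ^ n * y + t + d i) / β :=
      fun t y => by rw [pow_succ]; field_simp; ring
    refine ⟨(Finset.univ.filter fun k => B i k = 1).biUnion fun k =>
      (T k).image fun t => (t + d i) / β, ?_, ?_⟩
    · have hinj : Function.Injective fun t => (t + d i) / β := fun s t hst => by
        simpa [hβ.ne'] using hst
      rw [Finset.card_biUnion]
      · rw [pow_succ', Matrix.mul_apply, Finset.sum_filter]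
        refine Finset.sum_congr rfl fun k _ => ?_
        split_ifs with hk
        · rw [Finset.card_image_of_injective _ hinj, hcard, hk, one_mul]
        · have := h.le_one i k
          have h0 : B i k = 0 := by omega
          simp [h0]
      · intro k _ l _ hkl
        rw [Function.onFun, Finset.disjoint_left]
        intro s hs hs'
        obtain ⟨t, ht, rfl⟩ := Finset.mem_image.1 hs
        obtain ⟨t', ht', htt⟩ := Finset.mem_image.1 hs'
        obtain rfl := hinj htt
        have hy : (a j + b j) / 2 ∈ Set.Ioo (a j) (b j) := by
          have := h.lt j
          constructor <;> linarith
        exact hkl (h.eq_of_mem k l _ (hT k _ ht _ hy).1 (hT l _ ht' _ hy).1)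
    · intro s hs y hy
      obtain ⟨k, hk, hs⟩ := Finset.mem_biUnion.1 hs
      obtain ⟨t, ht, rfl⟩ := Finset.mem_image.1 hs
      have hk : B i k = 1 := by simpa using hk
      obtain ⟨h1, h2, h3⟩ := hT k t ht y hy
      obtain ⟨h4, h5⟩ := h.inverse_branch hk h1
      rw [hdiv]
      refine ⟨h4, by rw [Function.iterate_succ_apply, h5, h2], fun m hm => ?_⟩
      cases m with
      | zero => exact ⟨i, h4⟩
      | succ m =>
        rw [Function.iterate_succ_apply, h5]
        exact h3 m (by omega)

/-- Closed paths at `i` give similarities of one interval into itself. In `3 * M + 5`, two maps are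
lost at the end points, and one residue class mod 3 must retain `M + 1 > 1` of the others. -/
theorem le_dimH_of_diag [Fintype ι] [DecidableEq ι] (h : IsMarkovFamily β G a b d B) {n : ℕ}
    (hn : 0 < n) (i : ι) {M : ℝ} (hM : 1 ≤ M) (hB : 3 * M + 5 ≤ (B ^ n) i i) :
    ENNReal.ofReal (Real.log M / (n * Real.log β)) ≤ dimH (orbitTrapped G a b) := by
  classical
  obtain ⟨T, hcard, hT⟩ := h.exists_translations n i i
  have hβ : 0 < β := by linarith [h.one_lt]
  have hab := h.lt i
  set r : ℝ := (β⁻¹) ^ n with hr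
  have hr0 : 0 < r := by positivity
  have hr1 : r < 1 := pow_lt_one₀ (by positivity) (inv_lt_one_of_one_lt₀ h.one_lt) hn.ne'
  set ℓ : ℝ := r * (b i - a i) with hℓ
  have hℓ0 : 0 < ℓ := mul_pos hr0 (sub_pos.2 hab)
  have hsep : ∀ t ∈ T, ∀ t' ∈ T, t ≠ t' → ℓ ≤ |t - t'| := by
    intro t ht t' ht' hne
    by_contra! hlt
    obtain ⟨hl1, hl2⟩ := abs_lt.1 hlt
    -- Two overlapping branches send the midpoint shifted by `-c` and by `c` to the same point;
    -- applying $G^n$ forces `c = 0`.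
    set c := (t - t') / (2 * r) with hc
    have hcr : 2 * (r * c) = t - t' := by rw [hc]; field_simp
    have hy : (a i + b i) / 2 - c ∈ Set.Ioo (a i) (b i) := by
      constructor <;> nlinarith
    have hy' : (a i + b i) / 2 + c ∈ Set.Ioo (a i) (b i) := by
      constructor <;> nlinarith
    have h1 := (hT t ht _ hy).2.1
    have h2 := (hT t' ht' _ hy').2.1
    have h3 : r * ((a i + b i) / 2 - c) + t = r * ((a i + b i) / 2 + c) + t' := by linarith
    rw [h3, h2] at h1
    have hc0 : c = 0 := by linarith
    rw [hc0] at hcr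
    exact hne (by linarith)
  have hclosed : ∀ t ∈ T, a i ≤ r * a i + t ∧ r * b i + t ≤ b i := by
    intro t ht
    have hcont : Continuous fun y => r * y + t := by fun_prop
    have hmaps : Set.MapsTo (fun y => r * y + t) (Set.Icc (a i) (b i)) (Set.Icc (a i) (b i)) := by
      rw [← closure_Ioo hab.ne]
      exact Set.MapsTo.closure (fun y hy => (hT t ht y hy).1) hcont
    exact ⟨(hmaps (Set.left_mem_Icc.2 hab.le)).1, (hmaps (Set.right_mem_Icc.2 hab.le)).2⟩
  -- The erased translations are those whose map fixes an end point of the interval.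
  set T' : Finset ℝ := (T.erase (a i - r * a i)).erase (b i - r * b i) with hT'
  have hcard' : T.card ≤ T'.card + 2 := by
    have h1 := Finset.pred_card_le_card_erase (s := T) (a := a i - r * a i)
    have h2 := Finset.pred_card_le_card_erase (s := T.erase (a i - r * a i))
      (a := b i - r * b i)
    rw [← hT'] at h2
    omega
  have hmaps : ∀ t ∈ T', ⌊t / ℓ⌋ % 3 ∈ Finset.Ico (0 : ℤ) 3 := fun t _ => by
    rw [Finset.mem_Ico]; omega
  have hM' : (3 * M + 3) ≤ (T'.card : ℝ) := by
    have h1 : (T.card : ℝ) ≤ T'.card + 2 := by exact_mod_cast hcard'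
    rw [hcard] at h1
    linarith
  obtain ⟨c, -, hc⟩ := Finset.exists_le_card_fiber_of_nsmul_le_card_of_maps_to
    (M := ℝ) (b := M + 1) hmaps ⟨0, by simp⟩ (by simp; linarith)
  -- Distinct translations in one class have floors differing by at least 3, hence lie at least `2 *
  -- ℓ` apart.
  set U := T'.filter fun t => ⌊t / ℓ⌋ % 3 = c with hU
  have hUT : ∀ t ∈ U, t ∈ T := fun t ht =>
    Finset.mem_of_mem_erase (Finset.mem_of_mem_erase (Finset.mem_filter.1 ht).1)
  have hUcard : 1 < U.card := by
    have : (1 : ℝ) < U.card := by linarith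
    exact_mod_cast this
  obtain ⟨S, hS, hSinv, hdim⟩ := exists_selfSimilar_subset_Ioo hUcard hr0 hr1 hab
    (fun t ht => by
      refine lt_of_le_of_ne (hclosed t (hUT t ht)).1 fun heq => ?_
      have h1 := Finset.ne_of_mem_erase (Finset.mem_of_mem_erase (Finset.mem_filter.1 ht).1)
      exact h1 (by linarith))
    (fun t ht => by
      refine lt_of_le_of_ne (hclosed t (hUT t ht)).2 fun heq => ?_
      have h1 := Finset.ne_of_mem_erase (Finset.mem_filter.1 ht).1
      exact h1 (by linarith))
    (fun t ht t' ht' hne => by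
      have h1 := hsep t (hUT t ht) t' (hUT t' ht') hne
      have h2 : ⌊t / ℓ⌋ % 3 = ⌊t' / ℓ⌋ % 3 :=
        (Finset.mem_filter.1 ht).2.trans (Finset.mem_filter.1 ht').2.symm
      have h3 : ⌊t / ℓ⌋ ≠ ⌊t' / ℓ⌋ := fun heq => by
        have := Int.abs_sub_lt_one_of_floor_eq_floor heq
        rw [← sub_div, abs_div, abs_of_pos hℓ0, div_lt_one hℓ0] at this
        linarith
      have f1 := Int.floor_le (t / ℓ)
      have f2 := Int.lt_floor_add_one (t / ℓ)
      have f3 := Int.floor_le (t' / ℓ)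
      have f4 := Int.lt_floor_add_one (t' / ℓ)
      have g1 : t / ℓ * ℓ = t := by field_simp
      have g2 : t' / ℓ * ℓ = t' := by field_simp
      rcases lt_or_gt_of_ne h3 with hlt | hlt
      · have h4 : ⌊t / ℓ⌋ + 3 ≤ ⌊t' / ℓ⌋ := by omega
        have h5 : (⌊t / ℓ⌋ : ℝ) + 3 ≤ ⌊t' / ℓ⌋ := by exact_mod_cast h4
        refine le_abs.2 (Or.inr ?_)
        nlinarith
      · have h4 : ⌊t' / ℓ⌋ + 3 ≤ ⌊t / ℓ⌋ := by omega
        have h5 : (⌊t' / ℓ⌋ : ℝ) + 3 ≤ ⌊t / ℓ⌋ := by exact_mod_cast h4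
        refine le_abs.2 (Or.inl ?_)
        nlinarith)
  have hSub : S ⊆ orbitTrapped G a b := by
    -- After `n` steps a point of `S` is again in `S`, so control of the first `n` steps suffices.
    have key : ∀ m : ℕ, ∀ y ∈ S, ∃ l, G^[m] y ∈ Set.Ioo (a l) (b l) := by
      intro m
      induction m using Nat.strong_induction_on with
      | _ m ih =>
        intro y hy
        obtain ⟨t, ht, y', hy', rfl⟩ := hSinv y hy
        obtain ⟨-, h2, h3⟩ := hT t (hUT t ht) y' (hS hy')
        rcases le_or_gt m n with hmn | hmn
        · exact h3 m hmn
        · obtain ⟨k, rfl⟩ := Nat.exists_eq_add_of_lt hmn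
          rw [show n + k + 1 = (k + 1) + n by ring, Function.iterate_add_apply, h2]
          exact ih (k + 1) (by omega) y' hy'
    exact fun y hy m => key m y hy
  refine le_trans (ENNReal.ofReal_le_ofReal ?_) (hdim.trans (dimH_mono hSub))
  have hlog : 0 < Real.log β := Real.log_pos h.one_lt
  rw [hr, Real.log_pow, Real.log_inv, mul_neg, neg_neg]
  have hn' : (0 : ℝ) < n := by exact_mod_cast hn
  refine div_le_div_of_nonneg_right (Real.log_le_log (by linarith) (by linarith)) (by positivity)

/-- A loop keeps a diagonal entry of every power at least 1, whereas spectral radius below 1 would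
make row sums decay. -/
theorem one_le_spectralRadius [Fintype ι] [DecidableEq ι] {i : ι} (hi : B i i = 1) :
    1 ≤ (spectralRadius ℂ (B.map (Nat.cast : ℕ → ℂ))).toReal := by
  have : Nonempty ι := ⟨i⟩
  by_contra! hlt
  set ρ := (spectralRadius ℂ (B.map (Nat.cast : ℕ → ℂ))).toReal with hρ
  have hρ0 : 0 ≤ ρ := ENNReal.toReal_nonneg
  have hdiag : ∀ n : ℕ, 1 ≤ (B ^ n) i i := by
    intro n
    induction n with
    | zero => simp
    | succ n ih =>
      rw [pow_succ, Matrix.mul_apply]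
      refine le_trans ?_ (Finset.single_le_sum (f := fun j => (B ^ n) i j * B j i)
        (fun _ _ => Nat.zero_le _) (Finset.mem_univ i))
      simpa [hi] using ih
  obtain ⟨n, hn, hn0⟩ := ((B.eventually_sum_pow_le_of_spectralRadius_lt
    (μ := (ρ + 1) / 2) (by linarith)).and (eventually_gt_atTop 0)).exists
  have h1 : ((B ^ n) i i : ℝ) ≤ ∑ j, ((B ^ n) i j : ℝ) :=
    Finset.single_le_sum (f := fun j => ((B ^ n) i j : ℝ)) (fun _ _ => Nat.cast_nonneg _)
      (Finset.mem_univ i)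
  have h2 : (1 : ℝ) ≤ (B ^ n) i i := by exact_mod_cast hdiag n
  have h3 : ((ρ + 1) / 2) ^ n < 1 := pow_lt_one₀ (by linarith) (by linarith) hn0.ne'
  linarith [hn i]

theorem dimH_le_of_spectralRadius_lt [Fintype ι] [DecidableEq ι] [Nonempty ι]
    (h : IsMarkovFamily β G a b d B) {μ : ℝ} (hμ : 1 ≤ μ)
    (hlt : (spectralRadius ℂ (B.map (Nat.cast : ℕ → ℂ))).toReal < μ) :
    dimH (orbitTrapped G a b) ≤ ENNReal.ofReal (Real.log μ / Real.log β) := by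
  classical
  have hle : ∀ i, b i - a i ≤ ∑ j, (b j - a j) := fun i =>
    Finset.single_le_sum (f := fun j => b j - a j) (fun j _ => by linarith [h.lt j])
      (Finset.mem_univ i)
  refine dimH_le_of_forall_cover (C := ∑ j, (b j - a j)) (K := Fintype.card ι)
    (Finset.sum_nonneg fun j _ => by linarith [h.lt j]) h.one_lt hμ ?_
  filter_upwards [B.eventually_sum_pow_le_of_spectralRadius_lt hlt] with n hn
  choose t ht1 ht2 ht3 using h.exists_cover hle n
  refine ⟨Finset.univ.biUnion t, ?_, ?_, ?_⟩
  · intro x hx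
    obtain ⟨i, hi⟩ := hx 0
    obtain ⟨u, hu, hxu⟩ := Set.mem_iUnion₂.1 (ht1 i ⟨hx, hi⟩)
    exact Set.mem_iUnion₂.2 ⟨u, Finset.mem_biUnion.2 ⟨i, Finset.mem_univ i, hu⟩, hxu⟩
  · intro u hu
    obtain ⟨i, -, hi⟩ := Finset.mem_biUnion.1 hu
    exact ht2 i u hi
  · have h1 : ((Finset.univ.biUnion t).card : ℝ) ≤ ∑ i, ∑ j, ((B ^ n) i j : ℝ) := by
      exact_mod_cast Finset.card_biUnion_le.trans (Finset.sum_le_sum fun i _ => ht3 i)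
    refine h1.trans ((Finset.sum_le_sum fun i _ => hn i).trans ?_)
    simp

theorem le_dimH_of_lt_spectralRadius [Fintype ι] [DecidableEq ι] [Nonempty ι]
    (h : IsMarkovFamily β G a b d B) {μ : ℝ} (hμ : 1 < μ)
    (hlt : μ < (spectralRadius ℂ (B.map (Nat.cast : ℕ → ℂ))).toReal) :
    ENNReal.ofReal (Real.log μ / Real.log β) ≤ dimH (orbitTrapped G a b) := by
  set ρ := (spectralRadius ℂ (B.map (Nat.cast : ℕ → ℂ))).toReal with hρ
  have hm : (0 : ℝ) < Fintype.card ι := by exact_mod_cast Fintype.card_pos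
  have hμ0 : 0 < μ := by linarith
  have htend : Tendsto (fun n : ℕ => (ρ / μ) ^ n) atTop atTop :=
    tendsto_pow_atTop_atTop_of_one_lt ((one_lt_div hμ0).2 hlt)
  -- The factor 16 works because $3\mu^n+5\le 8\mu^n$ and the diagonal bound divides by twice the
  -- size.
  obtain ⟨n, ⟨i, hi⟩, hn, hn0⟩ := (B.frequently_exists_spectralRadius_pow_le_diag.and_eventually
    ((htend.eventually_ge_atTop (16 * Fintype.card ι)).and (eventually_gt_atTop 0))).exists
  have hμn : 1 ≤ μ ^ n := one_le_pow₀ hμ.le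
  rw [div_pow, le_div_iff₀ (by positivity)] at hn
  have hB : 3 * μ ^ n + 5 ≤ ((B ^ n) i i : ℝ) := by
    refine le_trans ?_ hi
    rw [le_div_iff₀ (by positivity)]
    nlinarith
  have key := h.le_dimH_of_diag hn0 i hμn hB
  have hn' : (n : ℝ) ≠ 0 := by exact_mod_cast hn0.ne'
  rwa [Real.log_pow, mul_div_mul_left _ _ hn'] at key

theorem dimH_orbitTrapped [Fintype ι] [DecidableEq ι] (h : IsMarkovFamily β G a b d B) {i : ι}
    (hi : B i i = 1) :
    dimH (orbitTrapped G a b) = ENNReal.ofReal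
      (Real.log (spectralRadius ℂ (B.map (Nat.cast : ℕ → ℂ))).toReal / Real.log β) := by
  have : Nonempty ι := ⟨i⟩
  have hρ1 := one_le_spectralRadius hi
  set ρ := (spectralRadius ℂ (B.map (Nat.cast : ℕ → ℂ))).toReal with hρ
  have hcont : ContinuousAt (fun μ => ENNReal.ofReal (Real.log μ / Real.log β)) ρ :=
    ENNReal.continuous_ofReal.continuousAt.comp
      ((Real.continuousAt_log (by linarith)).div_const _)
  refine le_antisymm ?_ ?_
  · refine ge_of_tendsto
      (hcont.tendsto.mono_left (nhdsWithin_le_nhds (s := Set.Ioi ρ))) ?_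
    filter_upwards [self_mem_nhdsWithin] with μ hμ
    exact h.dimH_le_of_spectralRadius_lt (hρ1.trans (le_of_lt hμ)) hμ
  · rcases hρ1.eq_or_lt with h1 | h1
    · simp [← h1]
    · refine le_of_tendsto
        (hcont.tendsto.mono_left (nhdsWithin_le_nhds (s := Set.Iio ρ))) ?_
      filter_upwards [Ioo_mem_nhdsLT h1] with μ hμ
      exact h.le_dimH_of_lt_spectralRadius hμ.1 hμ.2

end IsMarkovFamily

end

/-! ### The Markov partition of the greedy map -/

namespace BetaExpansion

variable {β : ℝ} {N : ℕ}

theorem greedyMap_mem_Icc (h1 : 1 < β) (h2 : β < 2) {x : ℝ} (hx : x ∈ Set.Icc 0 (β - 1)⁻¹) :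
    greedyMap β x ∈ Set.Icc 0 (β - 1)⁻¹ := by
  have hβ : 0 < β := by linarith
  have hb : 0 < β - 1 := by linarith
  have ht : (β - 1)⁻¹ * (β - 1) = 1 := inv_mul_cancel₀ hb.ne'
  have hi : β⁻¹ * β = 1 := inv_mul_cancel₀ hβ.ne'
  have ht1 : 1 ≤ (β - 1)⁻¹ := (one_le_inv₀ hb).2 (by linarith)
  unfold greedyMap
  split_ifs with h
  · exact ⟨mul_nonneg hβ.le hx.1, by nlinarith⟩
  · exact ⟨by nlinarith, by nlinarith [hx.2]⟩

theorem holeEnd_pos (h1 : 1 < β) : 0 < holeEnd β N := by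
  have hb : 0 < β - 1 := by linarith
  unfold holeEnd; positivity

theorem holeEnd_lt (h1 : 1 < β) (hN : 1 ≤ N) : holeEnd β N < (β - 1)⁻¹ := by
  have hb : 0 < (β - 1)⁻¹ := inv_pos.2 (by linarith)
  exact mul_lt_of_lt_one_left hb
    (pow_lt_one₀ (by positivity) (inv_lt_one_of_one_lt₀ h1) (by omega))

theorem greedyOrbit_subset_Icc (h1 : 1 < β) (h2 : β < 2) {x : ℝ} (hx : x ∈ Set.Icc 0 (β - 1)⁻¹) :
    greedyOrbit β x ⊆ Set.Icc 0 (β - 1)⁻¹ := by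
  rintro _ ⟨n, rfl⟩
  exact Set.MapsTo.iterate (fun y hy => greedyMap_mem_Icc h1 h2 hy) n hx

theorem greedyMap_mem_greedyOrbit {x y : ℝ} (hy : y ∈ greedyOrbit β x) :
    greedyMap β y ∈ greedyOrbit β x := by
  obtain ⟨n, rfl⟩ := hy
  exact ⟨n + 1, Function.iterate_succ_apply' _ _ _⟩

theorem one_mem_partitionPoints : (1 : ℝ) ∈ partitionPoints β N :=
  Or.inl (Or.inr ⟨0, rfl⟩)

theorem holeEnd_mem_partitionPoints : holeEnd β N ∈ partitionPoints β N :=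
  Or.inr ⟨0, rfl⟩

theorem inv_mem_partitionPoints : β⁻¹ ∈ partitionPoints β N :=
  Or.inl (Or.inl (by simp))

theorem top_mem_partitionPoints : (β - 1)⁻¹ ∈ partitionPoints β N :=
  Or.inl (Or.inl (by simp))

theorem inv_lt_top (h1 : 1 < β) : β⁻¹ < (β - 1)⁻¹ :=
  inv_strictAnti₀ (by linarith) (by linarith)

theorem partitionPoints_subset_Icc (h1 : 1 < β) (h2 : β < 2) (hN : 1 ≤ N) :
    partitionPoints β N ⊆ Set.Icc 0 (β - 1)⁻¹ := by
  have hb : 0 < (β - 1)⁻¹ := inv_pos.2 (by linarith)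
  refine Set.union_subset (Set.union_subset ?_ ?_) ?_
  · rintro x (rfl | rfl | rfl)
    · exact ⟨le_rfl, hb.le⟩
    · exact ⟨inv_nonneg.2 (by linarith), (inv_lt_top h1).le⟩
    · exact ⟨hb.le, le_rfl⟩
  · exact greedyOrbit_subset_Icc h1 h2
      ⟨zero_le_one, (one_le_inv₀ (by linarith)).2 (by linarith)⟩
  · exact greedyOrbit_subset_Icc h1 h2 ⟨(holeEnd_pos h1).le, (holeEnd_lt h1 hN).le⟩

theorem greedyMap_mem_partitionPoints (h1 : 1 < β) {x : ℝ} (hx : x ∈ partitionPoints β N) :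
    greedyMap β x ∈ partitionPoints β N := by
  have hβ : β ≠ 0 := by linarith
  have hb : β - 1 ≠ 0 := by linarith
  have hi : 0 < β⁻¹ := inv_pos.2 (by linarith)
  rcases hx with ((rfl | rfl | rfl) | hx) | hx
  · rw [show greedyMap β 0 = 0 by simp [greedyMap, hi]]
    exact Or.inl (Or.inl (by simp))
  · rw [show greedyMap β β⁻¹ = 0 by simp [greedyMap, hβ]]
    exact Or.inl (Or.inl (by simp))
  · rw [show greedyMap β (β - 1)⁻¹ = (β - 1)⁻¹ by
      rw [greedyMap, if_neg (not_lt.2 (inv_lt_top h1).le)]; field_simp; ring]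
    exact top_mem_partitionPoints
  · exact Or.inl (Or.inr (greedyMap_mem_greedyOrbit hx))
  · exact Or.inr (greedyMap_mem_greedyOrbit hx)

/-- The digit of the greedy expansion on an interval of the partition. -/
noncomputable def greedyDigit (β a : ℝ) : ℝ := if a < β⁻¹ then 0 else 1

theorem partitionIntervals.notMem {I : ℝ × ℝ} (hI : I ∈ partitionIntervals β N) {p : ℝ}
    (hp : p ∈ partitionPoints β N) : p ∉ Set.Ioo I.1 I.2 :=
  fun h => Set.disjoint_left.1 hI.2.2.2.1 h hp

theorem partitionIntervals.le_fst {I : ℝ × ℝ} (hI : I ∈ partitionIntervals β N) {p x : ℝ}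
    (hp : p ∈ partitionPoints β N) (hx : x ∈ Set.Ioo I.1 I.2) (hpx : p < x) : p ≤ I.1 := by
  by_contra! h
  exact partitionIntervals.notMem hI hp ⟨h, hpx.trans hx.2⟩

theorem partitionIntervals.snd_le {I : ℝ × ℝ} (hI : I ∈ partitionIntervals β N) {p x : ℝ}
    (hp : p ∈ partitionPoints β N) (hx : x ∈ Set.Ioo I.1 I.2) (hpx : x < p) : I.2 ≤ p := by
  by_contra! h
  exact partitionIntervals.notMem hI hp ⟨hx.1.trans hpx, h⟩

theorem partitionIntervals.greedyMap_eq {I : ℝ × ℝ} (hI : I ∈ partitionIntervals β N) {x : ℝ}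
    (hx : x ∈ Set.Ioo I.1 I.2) : greedyMap β x = β * x - greedyDigit β I.1 := by
  unfold greedyMap greedyDigit
  by_cases h : I.1 < β⁻¹
  · have hx' : x < β⁻¹ := by
      by_contra! h'
      exact partitionIntervals.notMem hI inv_mem_partitionPoints ⟨h, h'.trans_lt hx.2⟩
    rw [if_pos h, if_pos hx', sub_zero]
  · rw [if_neg h, if_neg (by linarith [hx.1, not_lt.1 h])]

theorem partitionIntervals.fst_image_mem (h1 : 1 < β) {I : ℝ × ℝ}
    (hI : I ∈ partitionIntervals β N) :
    β * I.1 - greedyDigit β I.1 ∈ partitionPoints β N := by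
  have : greedyMap β I.1 = β * I.1 - greedyDigit β I.1 := by
    unfold greedyMap greedyDigit
    split_ifs <;> simp
  rw [← this]
  exact greedyMap_mem_partitionPoints h1 hI.1

theorem partitionIntervals.snd_image_mem (h1 : 1 < β) {I : ℝ × ℝ}
    (hI : I ∈ partitionIntervals β N) :
    β * I.2 - greedyDigit β I.1 ∈ partitionPoints β N := by
  have h := greedyMap_mem_partitionPoints h1 hI.2.1
  unfold greedyMap at h
  unfold greedyDigit
  rcases lt_trichotomy I.2 β⁻¹ with h2 | h2 | h2
  · rw [if_pos h2] at h
    rwa [if_pos (hI.2.2.1.trans h2), sub_zero]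
  -- At the discontinuity the left limit of $G$ is 1, not $G(\beta^{-1})=0$; hence the orbit of 1
  -- among the division points.
  · rw [if_pos (hI.2.2.1.trans_eq h2), h2, mul_inv_cancel₀ (by linarith), sub_zero]
    exact one_mem_partitionPoints
  · rw [if_neg h2.not_gt] at h
    rwa [if_neg fun h3 => partitionIntervals.notMem hI inv_mem_partitionPoints ⟨h3, h2⟩]

theorem partitionIntervals.preimage_mem (h1 : 1 < β) {I : ℝ × ℝ} {y : ℝ}
    (hy : y ∈ Set.Ioo (β * I.1 - greedyDigit β I.1) (β * I.2 - greedyDigit β I.1)) :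
    (y + greedyDigit β I.1) / β ∈ Set.Ioo I.1 I.2 := by
  have hβ : 0 < β := by linarith
  exact ⟨by rw [lt_div_iff₀ hβ]; linarith [hy.1], by rw [div_lt_iff₀ hβ]; linarith [hy.2]⟩

theorem partitionIntervals.Ioo_subset_image (h1 : 1 < β) {I : ℝ × ℝ}
    (hI : I ∈ partitionIntervals β N) :
    Set.Ioo (β * I.1 - greedyDigit β I.1) (β * I.2 - greedyDigit β I.1) ⊆
      greedyMap β '' Set.Ioo I.1 I.2 := fun y hy =>
  ⟨_, preimage_mem h1 hy, by
    rw [greedyMap_eq hI (preimage_mem h1 hy), mul_div_cancel₀ _ (by linarith)]; ring⟩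

open Classical in
/-- The adjacency matrix of the Markov partition, with natural number entries. -/
noncomputable def transitionCount (β : ℝ) (N : ℕ) :
    Matrix (partitionIntervals β N) (partitionIntervals β N) ℕ :=
  Matrix.of fun I J =>
    if Set.Ioo J.1.1 J.1.2 ⊆ greedyMap β '' Set.Ioo I.1.1 I.1.2 then 1 else 0

theorem transitionCount_map_cast :
    (transitionCount β N).map (Nat.cast : ℕ → ℂ) = transitionMatrix β N := by
  ext I J
  simp [transitionCount, transitionMatrix]

theorem isMarkovFamily (h1 : 1 < β) (N : ℕ) :
    IsMarkovFamily β (greedyMap β) (fun I : partitionIntervals β N => I.1.1) (fun I => I.1.2)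
      (fun I => greedyDigit β I.1.1) (transitionCount β N) where
  one_lt := h1
  lt := fun I => I.2.2.2.1
  eq_of_mem := fun I J x hI hJ => by
    refine Subtype.ext (Prod.ext (le_antisymm ?_ ?_) (le_antisymm ?_ ?_))
    · exact partitionIntervals.le_fst J.2 I.2.1 hJ hI.1
    · exact partitionIntervals.le_fst I.2 J.2.1 hI hJ.1
    · exact partitionIntervals.snd_le I.2 J.2.2.1 hI hJ.2
    · exact partitionIntervals.snd_le J.2 I.2.2.1 hJ hI.2
  map_eq := fun I x hx => partitionIntervals.greedyMap_eq I.2 hx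
  le_one := fun I J => by
    simp only [transitionCount, Matrix.of_apply]; split_ifs <;> simp
  one_of_mem := fun I J x hx hGx => by
    simp only [transitionCount, Matrix.of_apply, ite_eq_left_iff, zero_ne_one, imp_false, not_not]
    refine subset_trans ?_ (partitionIntervals.Ioo_subset_image h1 I.2)
    have hG := partitionIntervals.greedyMap_eq I.2 hx
    refine Set.Ioo_subset_Ioo ?_ ?_
    · refine partitionIntervals.le_fst J.2 (partitionIntervals.fst_image_mem h1 I.2) hGx ?_
      rw [hG]; nlinarith [hx.1]
    · refine partitionIntervals.snd_le J.2 (partitionIntervals.snd_image_mem h1 I.2) hGx ?_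
      rw [hG]; nlinarith [hx.2]
  subset_image := fun I J h => by
    by_contra hn
    simp [transitionCount, hn] at h

theorem exists_partitionIntervals_mem (h : (partitionPoints β N).Finite) {x : ℝ} (hx : x ∈ Set.Icc 0 (β - 1)⁻¹)
    (hxP : x ∉ partitionPoints β N) (hxh : holeEnd β N < x) :
    ∃ I : partitionIntervals β N, x ∈ Set.Ioo I.1.1 I.1.2 := by
  have hxt : x < (β - 1)⁻¹ :=
    lt_of_le_of_ne hx.2 fun h' => hxP (h' ▸ top_mem_partitionPoints)
  obtain ⟨a, ha, ha'⟩ := Set.exists_max_image (partitionPoints β N ∩ Set.Iio x) id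
    (h.inter_of_left _) ⟨_, holeEnd_mem_partitionPoints, hxh⟩
  obtain ⟨b, hb, hb'⟩ := Set.exists_min_image (partitionPoints β N ∩ Set.Ioi x) id
    (h.inter_of_left _) ⟨_, top_mem_partitionPoints, hxt⟩
  refine ⟨⟨(a, b), ha.1, hb.1, lt_trans (b := x) ha.2 hb.2, ?_,
    ha' _ ⟨holeEnd_mem_partitionPoints, hxh⟩⟩, ha.2, hb.2⟩
  rw [Set.disjoint_left]
  intro p hp hpP
  rcases lt_trichotomy p x with hpx | rfl | hpx
  · exact absurd (ha' p ⟨hpP, hpx⟩) (not_le.2 hp.1)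
  · exact hxP hpP
  · exact absurd (hb' p ⟨hpP, hpx⟩) (not_le.2 hp.2)

/-- The last interval ends at the expanding fixed point $(\beta-1)^{-1}$, so it covers itself. -/
theorem exists_transitionCount_self_eq_one (h1 : 1 < β) (hN : 1 ≤ N)
    (h : (partitionPoints β N).Finite) :
    ∃ I : partitionIntervals β N, transitionCount β N I I = 1 := by
  obtain ⟨a, ha, ha'⟩ := Set.exists_max_image (partitionPoints β N ∩ Set.Iio (β - 1)⁻¹) id
    (h.inter_of_left _) ⟨_, holeEnd_mem_partitionPoints, holeEnd_lt h1 hN⟩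
  have hI : (a, (β - 1)⁻¹) ∈ partitionIntervals β N := by
    refine ⟨ha.1, top_mem_partitionPoints, ha.2, ?_,
      ha' _ ⟨holeEnd_mem_partitionPoints, holeEnd_lt h1 hN⟩⟩
    rw [Set.disjoint_left]
    exact fun p hp hpP => absurd (ha' p ⟨hpP, hp.2⟩) (not_le.2 hp.1)
  refine ⟨⟨_, hI⟩, ?_⟩
  have hda : greedyDigit β a = 1 :=
    if_neg (not_lt.2 (ha' _ ⟨inv_mem_partitionPoints, inv_lt_top h1⟩))
  simp only [transitionCount, Matrix.of_apply, ite_eq_left_iff, zero_ne_one, imp_false, not_not]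
  refine subset_trans ?_ (partitionIntervals.Ioo_subset_image h1 hI)
  have hb : 0 < β - 1 := by linarith
  have ht : (β - 1)⁻¹ * (β - 1) = 1 := inv_mul_cancel₀ hb.ne'
  have hat : a < (β - 1)⁻¹ := ha.2
  refine Set.Ioo_subset_Ioo ?_ ?_ <;> simp only [hda] <;> nlinarith

theorem countable_preimage_greedyMap {S : Set ℝ} (h1 : 1 < β) (hS : S.Countable) :
    (greedyMap β ⁻¹' S).Countable := by
  refine ((hS.image fun y => y / β).union (hS.image fun y => (y + 1) / β)).mono fun x hx => ?_
  have hβ : β ≠ 0 := by linarith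
  by_cases h : x < β⁻¹
  · exact Or.inl ⟨_, hx, by simp only [greedyMap, if_pos h]; field_simp⟩
  · exact Or.inr ⟨_, hx, by simp only [greedyMap, if_neg h]; field_simp; ring⟩

theorem countable_preimage_iterate_greedyMap {S : Set ℝ} (h1 : 1 < β) (hS : S.Countable) (n : ℕ) :
    ((greedyMap β)^[n] ⁻¹' S).Countable := by
  induction n with
  | zero => exact hS
  | succ n ih =>
    rw [Function.iterate_succ, Set.preimage_comp]
    exact countable_preimage_greedyMap h1 ih

/-- The two sets differ only by points whose orbit meets the finite set of division points; these
are countable since $G$ has two inverse branches. -/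
theorem dimH_greedySurvivors_eq_dimH_orbitTrapped (h1 : 1 < β) (h2 : β < 2) (hN : 1 ≤ N)
    (h : (partitionPoints β N).Finite) :
    dimH (greedySurvivors β N) = dimH (orbitTrapped (greedyMap β)
      (fun I : partitionIntervals β N => I.1.1) (fun I => I.1.2)) := by
  refine le_antisymm ?_ (dimH_mono ?_)
  · have hsub : greedySurvivors β N ⊆ (orbitTrapped (greedyMap β)
        (fun I : partitionIntervals β N => I.1.1) (fun I => I.1.2)) ∪
        ⋃ n : ℕ, (greedyMap β)^[n] ⁻¹' partitionPoints β N := by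
      intro x hx
      by_cases hP : ∃ n : ℕ, (greedyMap β)^[n] x ∈ partitionPoints β N
      · exact Or.inr (Set.mem_iUnion.2 hP)
      · push Not at hP
        refine Or.inl fun n => ?_
        have hmem : (greedyMap β)^[n] x ∈ greedyOrbit β x := ⟨n, rfl⟩
        have hE := greedyOrbit_subset_Icc h1 h2 hx.1 hmem
        refine exists_partitionIntervals_mem h hE (hP n) ?_
        by_contra! hle
        exact hx.2 _ hmem ⟨hE.1, hle⟩
    refine (dimH_mono hsub).trans ?_
    rw [dimH_union, dimH_countable (Set.countable_iUnion fun n =>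
      countable_preimage_iterate_greedyMap h1 h.countable n)]
    simp
  · intro x hx
    refine ⟨?_, ?_⟩
    · obtain ⟨I, hI⟩ := hx 0
      exact ⟨(partitionPoints_subset_Icc h1 h2 hN I.2.1).1.trans hI.1.le,
        hI.2.le.trans (partitionPoints_subset_Icc h1 h2 hN I.2.2.1).2⟩
    · rintro _ ⟨n, rfl⟩ hy
      obtain ⟨I, hI⟩ := hx n
      exact absurd (I.2.2.2.2.2.trans_lt hI.1) (not_lt.2 hy.2)

theorem dimH_greedySurvivors (h1 : 1 < β) (h2 : β < 2) (hN : 1 ≤ N)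
    (h : (partitionPoints β N).Finite) :
    1 ≤ transitionRadius β N h ∧ dimH (greedySurvivors β N) =
      ENNReal.ofReal (Real.log (transitionRadius β N h) / Real.log β) := by
  classical
  let _ : Fintype (partitionIntervals β N) := (partitionIntervals_finite h).fintype
  obtain ⟨I, hI⟩ := exists_transitionCount_self_eq_one h1 hN h
  have hr : transitionRadius β N h =
      (spectralRadius ℂ ((transitionCount β N).map (Nat.cast : ℕ → ℂ))).toReal := by
    rw [transitionCount_map_cast, transitionRadius]
  rw [hr]
  exact ⟨IsMarkovFamily.one_le_spectralRadius hI,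
    (dimH_greedySurvivors_eq_dimH_orbitTrapped h1 h2 hN h).trans
      ((isMarkovFamily h1 N).dimH_orbitTrapped hI)⟩

end BetaExpansion

/-! ### Finiteness of the orbits of 1 and of the hole end -/

namespace BetaExpansion

variable {β : ℝ} {N : ℕ}

theorem iterate_randomMap_one (n : ℕ) (x : ℝ) :
    (randomMap β)^[n] (fun _ => 1, x) = (fun _ => 1, (greedyMap β)^[n] x) := by
  induction n generalizing x with
  | zero => rfl
  | succ n ih =>
    have : randomMap β (fun _ => 1, x) = (fun _ => 1, greedyMap β x) := by
      simp only [randomMap, greedyMap]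
      split_ifs <;> simp
    rw [Function.iterate_succ_apply, this, ih, Function.iterate_succ_apply]

/-- Always choosing digit 0 gives the lazy map, conjugate to the greedy map by
$x\mapsto(\beta-1)^{-1}-x$. -/
theorem iterate_randomMap_zero (h1 : 1 < β) (h2 : β < 2) (n : ℕ) (x : ℝ) :
    (randomMap β)^[n] (fun _ => 0, (β - 1)⁻¹ - x) =
      (fun _ => 0, (β - 1)⁻¹ - (greedyMap β)^[n] x) := by
  induction n generalizing x with
  | zero => rfl
  | succ n ih =>
    have hb : 0 < β - 1 := by linarith
    have hβ : 0 < β := by linarith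
    have hi : 0 < β⁻¹ := inv_pos.2 hβ
    have ht1 : 1 ≤ (β - 1)⁻¹ := (one_le_inv₀ hb).2 (by linarith)
    have hs : β⁻¹ * (β - 1)⁻¹ = (β - 1)⁻¹ - β⁻¹ := by field_simp; ring
    have hc : β * (β - 1)⁻¹ = (β - 1)⁻¹ + 1 := by field_simp; ring
    have : randomMap β (fun _ => 0, (β - 1)⁻¹ - x) =
        (fun _ => 0, (β - 1)⁻¹ - greedyMap β x) := by
      simp only [randomMap, greedyMap]
      split_ifs with hx hx' hx' hx' hx'
      · nlinarith
      · simp only [Prod.mk.injEq, true_and]; linarith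
      · linarith
      · simp only [Fin.val_zero, Nat.cast_zero, Prod.mk.injEq, true_and]; linarith
      · simp only [Prod.mk.injEq, true_and]; linarith
      · linarith
    rw [Function.iterate_succ_apply, this, ih, Function.iterate_succ_apply]

theorem greedyOrbit_subset_possibleOrbits (x : ℝ) : greedyOrbit β x ⊆ possibleOrbits β x := by
  rintro _ ⟨n, rfl⟩
  exact ⟨fun _ => 1, n, by rw [iterate_randomMap_one]⟩

theorem greedyOrbit_subset_reflection_possibleOrbits (h1 : 1 < β) (h2 : β < 2) (x : ℝ) :
    greedyOrbit β ((β - 1)⁻¹ - x) ⊆ (fun y => (β - 1)⁻¹ - y) '' possibleOrbits β x := by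
  rintro _ ⟨n, rfl⟩
  refine ⟨_, ⟨fun _ => 0, n, rfl⟩, ?_⟩
  have h := iterate_randomMap_zero h1 h2 n ((β - 1)⁻¹ - x)
  rw [sub_sub_cancel] at h
  simp [h]

theorem greedyOrbit_finite_of_greedyMap {x : ℝ} (h : (greedyOrbit β (greedyMap β x)).Finite) :
    (greedyOrbit β x).Finite := by
  refine (h.insert x).subset ?_
  rintro _ ⟨n, rfl⟩
  cases n with
  | zero => exact Or.inl rfl
  | succ n => exact Or.inr ⟨n, rfl⟩

theorem greedyOrbit_holeEnd_finite (hg : (1 + Real.sqrt 5) / 2 < β) (h2 : β < 2)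
    (h : (possibleOrbits β 1).Finite) (n : ℕ) : (greedyOrbit β (holeEnd β (n + 1))).Finite := by
  have h5 : Real.sqrt 5 ^ 2 = 5 := Real.sq_sqrt (by norm_num)
  have h50 : 0 ≤ Real.sqrt 5 := Real.sqrt_nonneg 5
  have h1 : 1 < β := by nlinarith
  have hβ : 0 < β := by linarith
  have hb : 0 < β - 1 := by linarith
  have hc : 0 < (β - 1)⁻¹ := inv_pos.2 hb
  -- This is $\beta^2-\beta-1>0$, the golden ratio condition; it places $h_2,h_3,\dots$ below
  -- $\beta^{-1}$.
  have hcb : (β - 1)⁻¹ < β := by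
    rw [inv_lt_comm₀ hb hβ, inv_lt_iff_one_lt_mul₀ hβ]
    nlinarith
  induction n with
  | zero =>
    refine greedyOrbit_finite_of_greedyMap ?_
    have : greedyMap β (holeEnd β (0 + 1)) = (β - 1)⁻¹ - 1 := by
      have ht1 : 1 ≤ (β - 1)⁻¹ := (one_le_inv₀ hb).2 (by linarith)
      have : β⁻¹ ≤ β⁻¹ * (β - 1)⁻¹ := le_mul_of_one_le_right (inv_pos.2 hβ).le ht1
      rw [holeEnd, zero_add, pow_one, greedyMap, if_neg (not_lt.2 this), mul_inv_cancel_left₀ hβ.ne']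
    rw [this]
    exact (h.image _).subset (greedyOrbit_subset_reflection_possibleOrbits h1 h2 1)
  | succ n ih =>
    refine greedyOrbit_finite_of_greedyMap ?_
    have hlt : holeEnd β (n + 1 + 1) < β⁻¹ := by
      have hp : (β⁻¹) ^ n ≤ 1 := pow_le_one₀ (by positivity) (inv_le_one_of_one_le₀ h1.le)
      have h3 : β⁻¹ * (β - 1)⁻¹ < 1 := by rwa [inv_mul_lt_iff₀ hβ, mul_one]
      have h4 : (β⁻¹) ^ n * (β⁻¹ * (β - 1)⁻¹) < 1 :=
        (mul_le_of_le_one_left (by positivity) hp).trans_lt h3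
      calc holeEnd β (n + 1 + 1) = β⁻¹ * ((β⁻¹) ^ n * (β⁻¹ * (β - 1)⁻¹)) := by
            unfold holeEnd; ring
        _ < β⁻¹ := mul_lt_of_lt_one_right (by positivity) h4
    have : greedyMap β (holeEnd β (n + 1 + 1)) = holeEnd β (n + 1) := by
      rw [greedyMap, if_pos hlt, holeEnd, holeEnd, pow_succ' _ (n + 1), mul_assoc,
        mul_inv_cancel_left₀ hβ.ne']
    rwa [this]

theorem partitionPoints_finite (h : (greedyOrbit β 1).Finite)
    (h' : (greedyOrbit β (holeEnd β N)).Finite) : (partitionPoints β N).Finite :=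
  ((Set.toFinite _).union h).union h'

/-! ### Pisot numbers -/

open Polynomial

/-- `q(β) x` is the value at `β` of an integer polynomial whose values at the other conjugates
of `β` obey a bound that is stable under the branches of the `β`-transformations. -/
def HasControlledConjugates (β : ℝ) (q : ℤ[X]) (x : ℝ) : Prop :=
  ∃ p : ℤ[X], aeval β p = aeval β q * x ∧
    ∀ z : ℂ, aeval z (minpoly ℚ β) = 0 → z ≠ (β : ℂ) → ‖aeval z p‖ ≤ 2 / (1 - ‖z‖)

/-- The bound $2/(1-|z|)$ is the fixed point of $B\mapsto|z|B+2$, so one step of the map preserves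
it. -/
theorem HasControlledConjugates.mul_sub {q : ℤ[X]} {x : ℝ} (hβ : IsPisot β)
    (hq : ∀ z : ℂ, ‖z‖ < 1 → ‖aeval z q‖ ≤ 2) (h : HasControlledConjugates β q x) {d : ℤ}
    (hd : |(d : ℝ)| ≤ 1) : HasControlledConjugates β q (β * x - d) := by
  obtain ⟨p, hp, hpz⟩ := h
  refine ⟨X * p - C d * q, ?_, fun z hz hne => ?_⟩
  · simp [hp]; ring
  · have hz1 := hβ.2.2 z hz hne
    have h1 := hpz z hz hne
    have h0 : 0 < 1 - ‖z‖ := by linarith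
    calc ‖aeval z (X * p - C d * q)‖ = ‖z * aeval z p - d * aeval z q‖ := by simp
      _ ≤ ‖z‖ * ‖aeval z p‖ + ‖(d : ℂ)‖ * ‖aeval z q‖ := by
          rw [← norm_mul, ← norm_mul]; exact norm_sub_le _ _
      _ ≤ ‖z‖ * (2 / (1 - ‖z‖)) + 1 * 2 := by
          refine add_le_add (mul_le_mul_of_nonneg_left h1 (norm_nonneg z))
            (mul_le_mul ?_ (hq z hz1) (norm_nonneg _) zero_le_one)
          simpa using hd
      _ = 2 / (1 - ‖z‖) := by field_simp; ring

theorem HasControlledConjugates.of_mul_eq_one {q : ℤ[X]} {x : ℝ} (hβ : IsPisot β)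
    (h : aeval β q * x = 1) : HasControlledConjugates β q x := by
  refine ⟨1, by simp [h], fun z hz hne => ?_⟩
  have hz1 := hβ.2.2 z hz hne
  rw [map_one, norm_one, le_div_iff₀ (by linarith)]
  linarith [norm_nonneg z]

/-- Only finitely many algebraic integers of $\mathbb Q(\beta)$ are bounded in all embeddings; `x`
is such an integer divided by $q(\beta)$. -/
theorem finite_hasControlledConjugates {q : ℤ[X]} (hβ : IsPisot β) (hq : aeval β q ≠ 0) (c : ℝ) :
    {x : ℝ | |x| ≤ c ∧ HasControlledConjugates β q x}.Finite := by
  have hint : IsIntegral ℚ β := hβ.2.1.tower_top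
  let K := IntermediateField.adjoin ℚ {β}
  have : FiniteDimensional ℚ K := IntermediateField.adjoin.finiteDimensional hint
  have : NumberField K := { }
  let b : K := IntermediateField.AdjoinSimple.gen ℚ β
  -- The first term serves embeddings sending the generator to $\beta$, the sum all others.
  let bound : ℝ := |aeval β q| * c + ∑ φ : K →+* ℂ, |2 / (1 - ‖φ b‖)|
  refine ((NumberField.Embeddings.finite_of_norm_le K ℂ bound).image
    fun y : K => (y : ℝ) / aeval β q).subset ?_
  rintro x ⟨hx, p, hp, hpz⟩
  have hsum : 0 ≤ ∑ φ : K →+* ℂ, |2 / (1 - ‖φ b‖)| :=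
    Finset.sum_nonneg fun _ _ => abs_nonneg _
  have hval : ((aeval b p : K) : ℝ) = aeval β p := by
    have := Polynomial.aeval_algebraMap_apply ℝ b p
    simpa [b] using this.symm
  have hbint : IsIntegral ℤ b := by
    refine (isIntegral_algHom_iff (K.val.restrictScalars ℤ) Subtype.val_injective).1 ?_
    simpa [b] using hβ.2.1
  refine ⟨aeval b p, ⟨?_, fun φ => ?_⟩, ?_⟩
  · exact IsIntegral.of_mem_of_fg _ hbint.fg_adjoin_singleton _ (aeval_mem_adjoin_singleton ℤ b)
  · have hφ : φ (aeval b p) = aeval (φ b) p :=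
      (Polynomial.aeval_algHom_apply φ.toIntAlgHom b p).symm
    rw [hφ]
    by_cases hz : φ b = (β : ℂ)
    · have h1 : aeval (β : ℂ) p = ((aeval β p : ℝ) : ℂ) :=
        Polynomial.aeval_algebraMap_apply ℂ β p
      rw [hz, h1, Complex.norm_real, Real.norm_eq_abs, hp, abs_mul]
      have := mul_le_mul_of_nonneg_left hx (abs_nonneg (aeval β q))
      simp only [bound]
      linarith
    · have hroot : aeval (φ b) (minpoly ℚ β) = 0 := by
        have h1 : aeval (φ b) (minpoly ℚ b) = 0 := by
          have := Polynomial.aeval_algHom_apply φ.toRatAlgHom b (minpoly ℚ b)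
          rw [minpoly.aeval, map_zero] at this
          exact this
        rwa [show minpoly ℚ b = minpoly ℚ β from IntermediateField.minpoly_gen ℚ β] at h1
      have h2 := Finset.single_le_sum (f := fun φ : K →+* ℂ => |2 / (1 - ‖φ b‖)|)
        (fun _ _ => abs_nonneg _) (Finset.mem_univ φ)
      have h3 : 0 ≤ |aeval β q| * c := mul_nonneg (abs_nonneg _) ((abs_nonneg x).trans hx)
      have h4 := (hpz _ hroot hz).trans (le_abs_self _)
      simp only [bound]
      linarith
  · simp only [hval, hp]
    field_simp

theorem IsPisot.possibleOrbits_finite (hβ : IsPisot β) (h2 : β < 2) :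
    (possibleOrbits β 1).Finite := by
  have h1 := hβ.1
  have hb : 0 < β - 1 := by linarith
  have hi : β⁻¹ * β = 1 := inv_mul_cancel₀ (by linarith)
  have ht : (β - 1)⁻¹ * (β - 1) = 1 := inv_mul_cancel₀ hb.ne'
  have ht1 : 1 ≤ (β - 1)⁻¹ := (one_le_inv₀ hb).2 (by linarith)
  refine (finite_hasControlledConjugates hβ (q := 1) (by simp) (β - 1)⁻¹).subset ?_
  rintro _ ⟨ω, n, rfl⟩
  have key : ((randomMap β)^[n] (ω, 1)).2 ∈ Set.Icc 0 (β - 1)⁻¹ ∧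
      HasControlledConjugates β 1 ((randomMap β)^[n] (ω, 1)).2 := by
    induction n with
    | zero => exact ⟨⟨zero_le_one, ht1⟩, .of_mul_eq_one hβ (by simp)⟩
    | succ n ih =>
      rw [Function.iterate_succ_apply']
      generalize (randomMap β)^[n] (ω, 1) = s at ih ⊢
      obtain ⟨⟨hs0, hs1⟩, hs⟩ := ih
      have hq : ∀ z : ℂ, ‖z‖ < 1 → ‖aeval z (1 : ℤ[X])‖ ≤ 2 := fun z _ => by simp
      have hstep : ∀ d : ℤ, |(d : ℝ)| ≤ 1 → HasControlledConjugates β 1 (β * s.2 - d) :=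
        fun d hd => hs.mul_sub hβ hq hd
      have hz : HasControlledConjugates β 1 (β * s.2) := by simpa using hstep 0 (by simp)
      have ho : HasControlledConjugates β 1 (β * s.2 - 1) := by simpa using hstep 1 (by simp)
      unfold randomMap
      split_ifs with hx hx'
      · exact ⟨⟨by nlinarith, by nlinarith⟩, hz⟩
      · have hle : β * s.2 ≤ (β - 1)⁻¹ := by
          have := mul_le_mul_of_nonneg_left hx' (show 0 ≤ β by linarith)
          rwa [mul_inv_cancel_left₀ (by linarith)] at this
        generalize s.1 0 = e
        fin_cases e
        · simpa using ⟨⟨by nlinarith, hle⟩, hz⟩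
        · exact ⟨⟨by simp; nlinarith, by simp; linarith⟩, by simpa using ho⟩
      · have hβs : β⁻¹ ≤ s.2 := not_lt.1 hx
        exact ⟨⟨by nlinarith, by nlinarith⟩, ho⟩
  exact ⟨by rw [abs_of_nonneg key.1.1]; exact key.1.2, key.2⟩

/-- The factor $q=X^N(X-1)$ clears the denominator of $h_N$ and is bounded by 2 on the unit disc.
The orbit is treated directly, so no golden ratio condition enters. -/
theorem IsPisot.greedyOrbit_holeEnd_finite (hβ : IsPisot β) (h2 : β < 2) (hN : 1 ≤ N) :
    (greedyOrbit β (holeEnd β N)).Finite := by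
  have h1 := hβ.1
  have hb : 0 < β - 1 := by linarith
  have hβ0 : 0 < β := by linarith
  have hqβ : aeval β (X ^ N * (X - 1) : ℤ[X]) = β ^ N * (β - 1) := by simp
  refine (finite_hasControlledConjugates hβ (q := X ^ N * (X - 1))
    (by rw [hqβ]; positivity) (β - 1)⁻¹).subset fun y hy => ?_
  have hE := greedyOrbit_subset_Icc h1 h2 ⟨(holeEnd_pos h1).le, (holeEnd_lt h1 hN).le⟩ hy
  refine ⟨by rw [abs_of_nonneg hE.1]; exact hE.2, ?_⟩
  have hq : ∀ z : ℂ, ‖z‖ < 1 → ‖aeval z (X ^ N * (X - 1) : ℤ[X])‖ ≤ 2 := fun z hz => by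
    have h3 : ‖z‖ ^ N ≤ 1 := pow_le_one₀ (norm_nonneg z) hz.le
    have h4 : ‖z - 1‖ ≤ 2 := (norm_sub_le z 1).trans (by rw [norm_one]; linarith)
    simp only [map_mul, map_pow, map_sub, aeval_X, map_one, norm_mul, norm_pow]
    nlinarith [norm_nonneg (z - 1)]
  obtain ⟨n, rfl⟩ := hy
  clear hE
  induction n with
  | zero =>
    refine .of_mul_eq_one hβ ?_
    rw [hqβ]
    simp only [Function.iterate_zero, id, holeEnd, inv_pow]
    field_simp
  | succ n ih =>
    simp only [Function.iterate_succ_apply'] at ih ⊢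
    have hstep := fun d hd => ih.mul_sub hβ hq (d := d) hd
    generalize (greedyMap β)^[n] (holeEnd β N) = x at hstep ⊢
    unfold greedyMap
    split_ifs
    · simpa using hstep 0 (by simp)
    · simpa using hstep 1 (by simp)

end BetaExpansion

theorem corollary2p3 :
    (∀ β : ℝ, (1 + Real.sqrt 5) / 2 < β → β < 2 → (BetaExpansion.possibleOrbits β 1).Finite →
      ∀ N : ℕ, 3 ≤ N →
        ∃ h : (BetaExpansion.partitionPoints β N).Finite,
          1 ≤ BetaExpansion.transitionRadius β N h ∧
          dimH (BetaExpansion.greedySurvivors β N) =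
            ENNReal.ofReal (Real.log (BetaExpansion.transitionRadius β N h) / Real.log β)) ∧
    (∀ β : ℝ, BetaExpansion.IsPisot β → β < 2 →
      (BetaExpansion.possibleOrbits β 1).Finite ∧
      ∀ N : ℕ, 3 ≤ N →
        ∃ h : (BetaExpansion.partitionPoints β N).Finite,
          1 ≤ BetaExpansion.transitionRadius β N h ∧
          dimH (BetaExpansion.greedySurvivors β N) =
            ENNReal.ofReal (Real.log (BetaExpansion.transitionRadius β N h) / Real.log β)) := by
  refine ⟨fun β hg h2 hO N hN => ?_, fun β hβ h2 => ⟨hβ.possibleOrbits_finite h2, fun N hN => ?_⟩⟩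
  · have h5 : 1 < Real.sqrt 5 := by rw [Real.lt_sqrt] <;> norm_num
    have hfin : (BetaExpansion.partitionPoints β N).Finite := by
      refine BetaExpansion.partitionPoints_finite
        (hO.subset (BetaExpansion.greedyOrbit_subset_possibleOrbits 1)) ?_
      obtain ⟨n, rfl⟩ := Nat.exists_eq_add_of_le' (show 1 ≤ N by omega)
      exact BetaExpansion.greedyOrbit_holeEnd_finite hg h2 hO n
    exact ⟨hfin, BetaExpansion.dimH_greedySurvivors (by linarith) h2 (by omega) hfin⟩
  · have hfin : (BetaExpansion.partitionPoints β N).Finite :=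
      BetaExpansion.partitionPoints_finite
        ((hβ.possibleOrbits_finite h2).subset (BetaExpansion.greedyOrbit_subset_possibleOrbits 1))
        (hβ.greedyOrbit_holeEnd_finite h2 (by omega))
    exact ⟨hfin, BetaExpansion.dimH_greedySurvivors hβ.1 h2 (by omega) hfin⟩
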